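/- Let $n\geq 2$ and $r\geq 1$ be integers, and let $\mathfrak{C}_{n,r}=\{1,\ldots,r\}\times\{1,\ldots,n\}^{\omega}$ be the Cantor space of infinite sequences whose first digit lies in $\{1,\ldots,r\}$ and whose remaining digits lie in $\{1,\ldots,n\}$, with the product topology. For a finite prefix $\alpha\in\{1,\ldots,r\}\times\{1,\ldots,n\}^{*}$, the cone $C_\alpha$ is the set of sequences in $\mathfrak{C}_{n,r}$ that begin with $\alpha$; a prefix replacement is a map $C_\alpha\to C_\beta$ of the form $\alpha\psi\mapsto\beta\psi$. The Higman--Thompson group $V_{n,r}$ is the group of all homeomorphisms $f$ of $\mathfrak{C}_{n,r}$ such that each point of $\mathfrak{C}_{n,r}$ lies in a cone on which $f$ restricts to a prefix replacement. A point of $\mathfrak{C}_{n,r}$ is rational if its sequence of digits is eventually periodic. For $S\subseteq\mathfrak{C}_{n,r}$, let $\mathrm{Fix}(S)\leq V_{n,r}$ be the subgroup of elements that fix every point of $S$, and let $\mathrm{Fix}_0(S)\leq V_{n,r}$ be the subgroup of elements that are the identity on some neighborhood of $S$. Then for every finite (possibly empty) set $S$ of rational points in $\mathfrak{C}_{n,r}$,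 \[ [\mathrm{Fix}(S),\mathrm{Fix}(S)]=\mathrm{Fix}_0(S)\cap[V_{n,r},V_{n,r}], \] and this group is simple. -/

import Mathlib

/-- The Cantor space `{1,…,r} × {1,…,n}^ω`: an infinite sequence whose first digit lies in an
`r`-element set and whose remaining digits lie in an `n`-element set. It carries the product
topology of the discrete topologies. -/
abbrev CantorSp (n r : ℕ) : Type := Fin r × (ℕ → Fin n)

/-- Finite prefixes: elements of `{1,…,r} × {1,…,n}^*`. -/
abbrev CPrefix (n r : ℕ) : Type := Fin r × List (Fin n)

namespace CantorSp

variable {n r : ℕ}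

/-- The concatenation `wψ` of a finite word `w` and an infinite sequence `ψ`. -/
def appendSeq (w : List (Fin n)) (ψ : ℕ → Fin n) : ℕ → Fin n :=
  fun k => if h : k < w.length then w[k] else ψ (k - w.length)

/-- The infinite sequence `αψ` that begins with the prefix `α` and continues with `ψ`. -/
def prepend (α : CPrefix n r) (ψ : ℕ → Fin n) : CantorSp n r :=
  (α.1, appendSeq α.2 ψ)

/-- The cone of all sequences that have `α` as a prefix. -/
def cone (α : CPrefix n r) : Set (CantorSp n r) :=
  Set.range (prepend α)

/-- `f` restricts on the cone of `α` to the prefix replacement `αψ ↦ βψ`. -/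
def ActsAsPrefixReplacement (f : CantorSp n r → CantorSp n r) (α β : CPrefix n r) : Prop :=
  ∀ ψ : ℕ → Fin n, f (prepend α ψ) = prepend β ψ

/-- Thompson-like homeomorphisms of the whole Cantor space: each point is contained in a cone on
which `f` restricts to a prefix replacement. -/
def IsThompsonLike (f : CantorSp n r ≃ₜ CantorSp n r) : Prop :=
  ∀ x : CantorSp n r, ∃ α β : CPrefix n r, x ∈ cone α ∧ ActsAsPrefixReplacement f α β

/-- A point is rational if its sequence of digits is eventually periodic. -/
def IsRational (x : CantorSp n r) : Prop :=
  ∃ N p : ℕ, 0 < p ∧ ∀ k : ℕ, N ≤ k → x.2 (k + p) = x.2 k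

theorem appendSeq_append (u v : List (Fin n)) (ψ : ℕ → Fin n) :
    appendSeq (u ++ v) ψ = appendSeq u (appendSeq v ψ) := by
  funext k
  simp only [appendSeq, List.length_append]
  by_cases h1 : k < u.length
  · have h2 : k < u.length + v.length := by omega
    simp [h1, h2]
  · by_cases h2 : k < u.length + v.length
    · have h3 : k - u.length < v.length := by omega
      simp [h1, h2, h3, List.getElem_append]
    · have h3 : ¬ k - u.length < v.length := by omega
      simp [h1, h2, h3, Nat.sub_sub]

theorem appendSeq_ofFn (ψ : ℕ → Fin n) (m : ℕ) :
    appendSeq (List.ofFn fun i : Fin m => ψ i) (fun k => ψ (k + m)) = ψ := by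
  funext k
  by_cases h : k < m
  · simp [appendSeq, h]
  · simp [appendSeq, h, Nat.sub_add_cancel (not_lt.mp h)]

/-- If `wψ` begins with `v` and `v` is no longer than `w`, then `v` is an initial segment
of `w`. -/
theorem exists_eq_append {v w : List (Fin n)} {φ ψ : ℕ → Fin n} (h : v.length ≤ w.length)
    (e : appendSeq w ψ = appendSeq v φ) : ∃ t, w = v ++ t := by
  refine ⟨w.drop v.length, ?_⟩
  have : v = w.take v.length := by
    apply List.ext_getElem
    · simp [h]
    · intro k h1 _
      have h3 : k < w.length := by omega
      have := congrFun e k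
      simp only [appendSeq, h1, h3, dif_pos] at this
      simp [this]
  conv_lhs => rw [← List.take_append_drop v.length w, ← this]

theorem IsThompsonLike.mul {f g : CantorSp n r ≃ₜ CantorSp n r} (hf : IsThompsonLike f)
    (hg : IsThompsonLike g) : IsThompsonLike (f * g) := by
  intro x
  obtain ⟨α, β, ⟨ψ, rfl⟩, hαβ⟩ := hg x
  obtain ⟨γ, δ, ⟨φ, hφ⟩, hγδ⟩ := hf (g (prepend α ψ))
  rw [hαβ ψ] at hφ
  let u : List (Fin n) := List.ofFn fun i : Fin γ.2.length => ψ i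
  let ψ' : ℕ → Fin n := fun k => ψ (k + γ.2.length)
  have hu : appendSeq u ψ' = ψ := appendSeq_ofFn ψ γ.2.length
  have h1 : γ.1 = β.1 := congrArg (fun y : CantorSp n r => y.1) hφ
  have h2 : appendSeq (β.2 ++ u) ψ' = appendSeq γ.2 φ := by
    rw [appendSeq_append, hu]
    exact (congrArg (fun y : CantorSp n r => y.2) hφ).symm
  obtain ⟨v, hv⟩ := exists_eq_append (by simp [u]) h2
  refine ⟨(α.1, α.2 ++ u), (δ.1, δ.2 ++ v), ⟨ψ', ?_⟩, ?_⟩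
  · simp [prepend, appendSeq_append, hu]
  · intro χ
    have e1 : prepend (α.1, α.2 ++ u) χ = prepend α (appendSeq u χ) := by
      simp [prepend, appendSeq_append]
    have e2 : prepend β (appendSeq u χ) = prepend γ (appendSeq v χ) := by
      simp only [prepend, ← appendSeq_append, hv, h1]
    have e3 : prepend (δ.1, δ.2 ++ v) χ = prepend δ (appendSeq v χ) := by
      simp [prepend, appendSeq_append]
    change f (g _) = _
    rw [e1, hαβ, e2, hγδ, e3]

theorem isThompsonLike_one : IsThompsonLike (1 : CantorSp n r ≃ₜ CantorSp n r) := by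
  intro x
  refine ⟨(x.1, []), (x.1, []), ⟨x.2, ?_⟩, fun ψ => rfl⟩
  refine Prod.ext rfl (funext fun k => ?_)
  simp [prepend, appendSeq]

theorem IsThompsonLike.inv {f : CantorSp n r ≃ₜ CantorSp n r} (hf : IsThompsonLike f) :
    IsThompsonLike f⁻¹ := by
  intro x
  obtain ⟨α, β, ⟨ψ, hψ⟩, hαβ⟩ := hf (f.symm x)
  refine ⟨β, α, ⟨ψ, ?_⟩, fun χ => ?_⟩
  · rw [← hαβ, hψ, f.apply_symm_apply]
  · change f.symm _ = _
    rw [← hαβ, f.symm_apply_apply]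

end CantorSp

/-- The Higman–Thompson group `V_{n,r}`: all Thompson-like homeomorphisms of the Cantor space,
under composition. -/
def HigmanThompson (n r : ℕ) : Subgroup (CantorSp n r ≃ₜ CantorSp n r) where
  carrier := {f | CantorSp.IsThompsonLike f}
  mul_mem' := CantorSp.IsThompsonLike.mul
  one_mem' := CantorSp.isThompsonLike_one
  inv_mem' := CantorSp.IsThompsonLike.inv

namespace HigmanThompson

variable {n r : ℕ}

/-- The pointwise stabilizer `Fix(S)` in `V_{n,r}`. -/
def Fix (S : Set (CantorSp n r)) : Subgroup (HigmanThompson n r) where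
  carrier := {f | ∀ x ∈ S, f.1 x = x}
  mul_mem' := by
    intro f g hf hg x hx
    change f.1 (g.1 x) = x
    rw [hg x hx, hf x hx]
  one_mem' := fun _ _ => rfl
  inv_mem' := by
    intro f hf x hx
    change f.1.symm x = x
    rw [Homeomorph.symm_apply_eq, hf x hx]

/-- The subgroup `Fix₀(S)` of the elements of `V_{n,r}` that are the identity in some
neighborhood of `S`. -/
def FixNear (S : Set (CantorSp n r)) : Subgroup (HigmanThompson n r) where
  carrier := {f | ∃ U : Set (CantorSp n r), IsOpen U ∧ S ⊆ U ∧ ∀ x ∈ U, f.1 x = x}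
  mul_mem' := by
    rintro f g ⟨U, hU, hSU, hf⟩ ⟨W, hW, hSW, hg⟩
    refine ⟨U ∩ W, hU.inter hW, Set.subset_inter hSU hSW, fun x hx => ?_⟩
    change f.1 (g.1 x) = x
    rw [hg x hx.2, hf x hx.1]
  one_mem' := ⟨Set.univ, isOpen_univ, Set.subset_univ _, fun _ _ => rfl⟩
  inv_mem' := by
    rintro f ⟨U, hU, hSU, hf⟩
    refine ⟨U, hU, hSU, fun x hx => ?_⟩
    change f.1.symm x = x
    rw [Homeomorph.symm_apply_eq, hf x hx]

end HigmanThompson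

/-!
Write `V` for the Higman–Thompson group.

*The commutator subgroup of a stabilizer.* Near a fixed point `s`, an element replaces a prefix of
`s` by another prefix of `s`, and the difference of their lengths is additive under composition.
Hence a commutator of elements fixing `s` has difference zero at `s` and is the identity near `s`
(`commutator_fix_le_fixNear`). Conversely, let `f` be trivial near `S`, and let `ι` be the
injective map that is the identity off a small neighborhood of `S` and squeezes that neighborhood
into a cone inside it that avoids `S`. Transport along `ι` is an endomorphism `J` of `V` that
fixes `f` and takes values in `Fix₀(S)`. If `f` is in `[V, V]`, then `f = J f` is therefore in
`[Fix₀(S), Fix₀(S)]`.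

*Reduction of simplicity to empty `S`.* Two elements of `Fix₀(S) ∩ [V, V]` are fixed by a common
`J` as above (`exists_endomorphism_into_fixNear`), so a normal subgroup containing one of them
pulls back along `J` to a subgroup of `V` that is normalized by `[V, V]`, and it suffices that
`[V, V]` is simple.

*Simplicity of `[V, V]`* (`commutator_le_of_normalized`). Let `N` be nontrivial and normalized by
`[V, V]`. Some `g` in `N` displaces a cone `C` from itself, and for `a`, `b` in `[V, V]` supported
in `C` one has `⁅⁅g, a⁻¹⁆, b⁆ = ⁅a, b⁆`. Since `[V, V]` moves every proper clopen set into `C`,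
the commutators of elements of `[V, V]` with common proper clopen support all lie in `N`, and even
in its normal core `M` in `V`. Now `V / M` is abelian: elements with a common proper support
commute modulo `M`, because multiplying them by displaced copies of their inverses brings them
into `[V, V]` without changing their commutator; hence modulo `M` a properly supported element can
be pushed into a small cone, so any two properly supported elements commute modulo `M`; and such
elements generate `V` (`exists_eq_mul_supportedIn`). Thus `[V, V] ≤ M ≤ N`.
-/

/-! ### Prefixes and the topology of the Cantor space -/

namespace CantorSp

open Filter Topology

variable {n r : ℕ}

/-- The prefix consisting of the first digit of `x` and the `k` digits after it. -/
def initial (x : CantorSp n r) (k : ℕ) : CPrefix n r :=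
  (x.1, List.ofFn fun i : Fin k => x.2 i)

@[simp]
theorem length_initial (x : CantorSp n r) (k : ℕ) : (initial x k).2.length = k := by
  simp [initial]

theorem prepend_initial (x : CantorSp n r) (k : ℕ) :
    prepend (initial x k) (fun j => x.2 (j + k)) = x :=
  Prod.ext rfl (appendSeq_ofFn x.2 k)

theorem prepend_append (α : CPrefix n r) (u : List (Fin n)) (ψ : ℕ → Fin n) :
    prepend (α.1, α.2 ++ u) ψ = prepend α (appendSeq u ψ) := by
  simp [prepend, appendSeq_append]

theorem appendSeq_inj {v w : List (Fin n)} {φ ψ : ℕ → Fin n} (h : v.length = w.length)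
    (e : appendSeq v φ = appendSeq w ψ) : v = w ∧ φ = ψ := by
  obtain ⟨t, rfl⟩ := exists_eq_append h.ge e
  obtain rfl : t = [] := by
    rw [List.length_append] at h
    exact List.length_eq_zero_iff.1 (by omega)
  refine ⟨by simp, funext fun k => ?_⟩
  have := congrFun e (k + w.length)
  simpa [appendSeq] using this

theorem appendSeq_eq_of_prepend_eq {α β : CPrefix n r} {φ ψ : ℕ → Fin n}
    (h : prepend α φ = prepend β ψ) : appendSeq α.2 φ = appendSeq β.2 ψ :=
  congrArg (fun y : CantorSp n r => y.2) h

theorem prepend_injective (α : CPrefix n r) : Function.Injective (prepend α) := fun _ _ h =>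
  (appendSeq_inj rfl (appendSeq_eq_of_prepend_eq h)).2

theorem appendSeq_nil (ψ : ℕ → Fin n) : appendSeq [] ψ = ψ :=
  funext fun k => by simp [appendSeq]

theorem mem_cone_initial (x : CantorSp n r) (k : ℕ) : x ∈ cone (initial x k) :=
  ⟨_, prepend_initial x k⟩

theorem initial_eq_of_mem_cone {x : CantorSp n r} {α : CPrefix n r} (h : x ∈ cone α) :
    initial x α.2.length = α := by
  obtain ⟨ψ, rfl⟩ := h
  have h := prepend_initial (prepend α ψ) α.2.length
  exact Prod.ext rfl (appendSeq_inj (by simp) (appendSeq_eq_of_prepend_eq h)).1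

theorem mem_cone_initial_iff {x y : CantorSp n r} {k : ℕ} :
    y ∈ cone (initial x k) ↔ y.1 = x.1 ∧ ∀ i < k, y.2 i = x.2 i := by
  constructor
  · rintro ⟨ψ, rfl⟩
    refine ⟨rfl, fun i hi => ?_⟩
    simp [prepend, appendSeq, initial, hi]
  · rintro ⟨h1, h2⟩
    have : initial x k = initial y k := by
      refine Prod.ext h1.symm ?_
      simp only [initial, List.ofFn_inj]
      exact funext fun i => (h2 i i.2).symm
    rw [this]
    exact mem_cone_initial y k

theorem initial_of_le (x : CantorSp n r) {k l : ℕ} (h : k ≤ l) :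
    ∃ t : List (Fin n), initial x l = ((initial x k).1, (initial x k).2 ++ t) := by
  obtain ⟨t, ht⟩ := exists_eq_append (v := (initial x k).2) (w := (initial x l).2)
    (by simpa using h)
    (appendSeq_eq_of_prepend_eq ((prepend_initial x l).trans (prepend_initial x k).symm))
  exact ⟨t, Prod.ext rfl ht⟩

theorem isClopen_cone_initial (x : CantorSp n r) (k : ℕ) : IsClopen (cone (initial x k)) := by
  have : cone (initial x k) = (fun y : CantorSp n r => y.1) ⁻¹' {x.1} ∩
      ⋂ i : Fin k, (fun y : CantorSp n r => y.2 i) ⁻¹' {x.2 i} := by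
    ext y
    rw [mem_cone_initial_iff]
    simp [Fin.forall_iff]
  rw [this]
  refine ((isClopen_discrete _).preimage continuous_fst).inter
    (isClopen_iInter_of_finite fun i => ?_)
  exact (isClopen_discrete _).preimage ((continuous_apply _).comp continuous_snd)

theorem eventually_cone_subset {U : Set (CantorSp n r)} (hU : IsOpen U) {x : CantorSp n r}
    (hx : x ∈ U) : ∀ᶠ k in atTop, cone (initial x k) ⊆ U := by
  obtain ⟨u, v, -, hv, hxu, hxv, huv⟩ := isOpen_prod_iff.1 hU x.1 x.2 hx
  obtain ⟨I, w, hw, hwv⟩ := isOpen_pi_iff.1 hv x.2 hxv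
  filter_upwards [eventually_gt_atTop (I.sup id)] with k hk y hy
  rw [mem_cone_initial_iff] at hy
  refine huv ⟨?_, hwv fun i hi => ?_⟩
  · rwa [hy.1]
  · rw [hy.2 i ((Finset.le_sup (f := id) hi).trans_lt hk)]
    exact (hw i hi).2

theorem exists_cone_subset {U : Set (CantorSp n r)} (hU : IsOpen U) {x : CantorSp n r}
    (hx : x ∈ U) : ∃ k, cone (initial x k) ⊆ U :=
  (eventually_cone_subset hU hx).exists

/-- The Cantor space has no isolated points. -/
theorem nonempty_diff_of_finite (hn : 2 ≤ n) {U F : Set (CantorSp n r)} (hU : IsOpen U)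
    (hne : U.Nonempty) (hF : F.Finite) : (U \ F).Nonempty := by
  obtain ⟨x, hx⟩ := hne
  obtain ⟨k, hk⟩ := exists_cone_subset hU hx
  have : Nontrivial (Fin n) := Fin.nontrivial_iff_two_le.2 hn
  exact (((Set.infinite_range_of_injective (prepend_injective (initial x k))).mono hk).sdiff
    hF).nonempty

theorem nonempty_of_pos (hn : 2 ≤ n) (hr : 1 ≤ r) : Nonempty (CantorSp n r) :=
  ⟨(⟨0, hr⟩, fun _ => ⟨0, by omega⟩)⟩

/-! ### Local prefix replacements and their germs -/

/-- A self-map of the Cantor space that is a prefix replacement on a cone around each point; it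
need not be bijective. -/
def IsLocallyPrefix (f : CantorSp n r → CantorSp n r) : Prop :=
  ∀ x, ∃ α β : CPrefix n r, x ∈ cone α ∧ ActsAsPrefixReplacement f α β

/-- Near `x`, the map `f` replaces a prefix by a prefix with `d` more digits. -/
def HasDegreeAt (f : CantorSp n r → CantorSp n r) (x : CantorSp n r) (d : ℤ) : Prop :=
  ∃ k β, ActsAsPrefixReplacement f (initial x k) β ∧ (β.2.length : ℤ) = k + d

theorem isLocallyPrefix_iff {f : CantorSp n r → CantorSp n r} :
    IsLocallyPrefix f ↔ ∀ x, ∃ d, HasDegreeAt f x d := by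
  constructor
  · intro h x
    obtain ⟨α, β, hx, hf⟩ := h x
    refine ⟨β.2.length - α.2.length, α.2.length, β, ?_, by ring⟩
    rwa [initial_eq_of_mem_cone hx]
  · intro h x
    obtain ⟨d, k, β, hf, -⟩ := h x
    exact ⟨_, β, mem_cone_initial x k, hf⟩

theorem HasDegreeAt.eventually {f : CantorSp n r → CantorSp n r} {x : CantorSp n r} {d : ℤ}
    (h : HasDegreeAt f x d) :
    ∀ᶠ k : ℕ in atTop, ∃ β, ActsAsPrefixReplacement f (initial x k) β ∧
      (β.2.length : ℤ) = k + d := by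
  obtain ⟨k, β, hf, hd⟩ := h
  filter_upwards [eventually_ge_atTop k] with l hl
  obtain ⟨t, ht⟩ := initial_of_le x hl
  have hlen := congrArg (fun α : CPrefix n r => α.2.length) ht
  simp only [length_initial, List.length_append] at hlen
  refine ⟨(β.1, β.2 ++ t), fun ψ => ?_, ?_⟩
  · rw [ht, prepend_append, prepend_append, hf]
  · simp only [List.length_append]
    push_cast
    omega

theorem IsLocallyPrefix.eventually {f : CantorSp n r → CantorSp n r} (h : IsLocallyPrefix f)
    (x : CantorSp n r) :
    ∀ᶠ k : ℕ in atTop, ∃ β, ActsAsPrefixReplacement f (initial x k) β := by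
  obtain ⟨d, hd⟩ := isLocallyPrefix_iff.1 h x
  exact hd.eventually.mono fun k ⟨β, hβ, _⟩ => ⟨β, hβ⟩

theorem ActsAsPrefixReplacement.apply_mem_cone
    {f : CantorSp n r → CantorSp n r} {α β : CPrefix n r}
    (h : ActsAsPrefixReplacement f α β) {x : CantorSp n r} (hx : x ∈ cone α) : f x ∈ cone β := by
  obtain ⟨ψ, rfl⟩ := hx
  exact ⟨ψ, (h ψ).symm⟩

theorem HasDegreeAt.comp {f g : CantorSp n r → CantorSp n r} {x : CantorSp n r} {d e : ℤ}
    (hf : HasDegreeAt f (g x) d) (hg : HasDegreeAt g x e) : HasDegreeAt (f ∘ g) x (d + e) := by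
  obtain ⟨m, hm⟩ := eventually_atTop.1 hf.eventually
  obtain ⟨k, hk, β, hβ, hd⟩ :=
    ((eventually_ge_atTop (m + e.natAbs)).and hg.eventually).exists
  have hβx := initial_eq_of_mem_cone (hβ.apply_mem_cone (mem_cone_initial x k))
  obtain ⟨γ, hγ, hc⟩ := hm β.2.length (by omega)
  rw [hβx] at hγ
  refine ⟨k, γ, fun ψ => ?_, by omega⟩
  rw [Function.comp_apply, hβ, hγ]

theorem HasDegreeAt.symm {f : CantorSp n r ≃ CantorSp n r} {x : CantorSp n r} {d : ℤ}
    (hf : HasDegreeAt f x d) : HasDegreeAt f.symm (f x) (-d) := by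
  obtain ⟨k, β, hβ, hd⟩ := hf
  have hβx := initial_eq_of_mem_cone (hβ.apply_mem_cone (mem_cone_initial x k))
  refine ⟨β.2.length, initial x k, fun ψ => ?_, by simp; omega⟩
  rw [hβx, Equiv.symm_apply_eq, hβ]

/-- A prefix replacement between prefixes of equal length that fixes a point is the identity. -/
theorem HasDegreeAt.eqOn_of_fixed {f : CantorSp n r → CantorSp n r} {x : CantorSp n r}
    (hf : HasDegreeAt f x 0) (hx : f x = x) : ∃ k, ∀ y ∈ cone (initial x k), f y = y := by
  obtain ⟨k, β, hβ, hd⟩ := hf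
  have hβx := initial_eq_of_mem_cone (hβ.apply_mem_cone (mem_cone_initial x k))
  obtain rfl : β.2.length = k := by omega
  refine ⟨β.2.length, ?_⟩
  rintro _ ⟨ψ, rfl⟩
  rw [hβ]
  conv_lhs => rw [← hβx, hx]

theorem IsLocallyPrefix.comp {f g : CantorSp n r → CantorSp n r} (hf : IsLocallyPrefix f)
    (hg : IsLocallyPrefix g) : IsLocallyPrefix (f ∘ g) := by
  rw [isLocallyPrefix_iff] at *
  intro x
  obtain ⟨e, he⟩ := hg x
  obtain ⟨d, hd⟩ := hf (g x)
  exact ⟨_, hd.comp he⟩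

theorem IsLocallyPrefix.symm {f : CantorSp n r ≃ CantorSp n r} (hf : IsLocallyPrefix f) :
    IsLocallyPrefix f.symm := by
  rw [isLocallyPrefix_iff] at *
  intro x
  obtain ⟨d, hd⟩ := hf (f.symm x)
  refine ⟨-d, ?_⟩
  simpa using hd.symm

theorem isLocallyPrefix_id : IsLocallyPrefix (id : CantorSp n r → CantorSp n r) := fun x =>
  ⟨initial x 0, initial x 0, mem_cone_initial x 0, fun _ => rfl⟩

/-- Being a local prefix replacement is a local property. -/
theorem isLocallyPrefix_of_local {f : CantorSp n r → CantorSp n r}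
    (h : ∀ x, ∃ U g, IsOpen U ∧ x ∈ U ∧ IsLocallyPrefix g ∧ Set.EqOn f g U) :
    IsLocallyPrefix f := by
  intro x
  obtain ⟨U, g, hU, hx, hg, hfg⟩ := h x
  obtain ⟨k, ⟨β, hβ⟩, hk⟩ := ((hg.eventually x).and (eventually_cone_subset hU hx)).exists
  exact ⟨initial x k, β, mem_cone_initial x k, fun ψ => (hfg (hk ⟨ψ, rfl⟩)).trans (hβ ψ)⟩

theorem continuous_prepend (α : CPrefix n r) : Continuous (prepend α) := by
  refine continuous_const.prodMk (continuous_pi fun k => ?_)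
  by_cases h : k < α.2.length
  · simpa [appendSeq, h] using continuous_const
  · simpa [appendSeq, h] using continuous_apply _

theorem IsLocallyPrefix.continuous {f : CantorSp n r → CantorSp n r} (hf : IsLocallyPrefix f) :
    Continuous f := by
  rw [continuous_iff_continuousAt]
  intro x
  obtain ⟨k, β, hβ⟩ := (hf.eventually x).exists
  have hc : Continuous fun y : CantorSp n r => prepend β fun j => y.2 (j + k) :=
    (continuous_prepend β).comp
      (continuous_pi fun j => (continuous_apply (j + k)).comp continuous_snd)
  refine hc.continuousAt.congr ?_
  filter_upwards [(isClopen_cone_initial x k).isOpen.mem_nhds (mem_cone_initial x k)] with y hy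
  have := initial_eq_of_mem_cone hy
  rw [length_initial] at this
  conv_rhs => rw [← prepend_initial y k, this, hβ]

/-- The whole Cantor space embeds into any cone by a local prefix replacement: the root cones are
sent to distinct cones of equal depth. -/
theorem exists_embedding_into_cone (hn : 2 ≤ n) (α : CPrefix n r) :
    ∃ e : CantorSp n r → CantorSp n r, IsLocallyPrefix e ∧ Function.Injective e ∧
      ∀ x, e x ∈ cone α := by
  let w : Fin r → List (Fin n) := fun i =>
    List.ofFn fun j : Fin r => if j = i then ⟨1, by omega⟩ else ⟨0, by omega⟩
  have hw : Function.Injective w := by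
    intro i j hij
    have := congrFun (List.ofFn_injective hij) i
    by_contra hne
    simp [hne] at this
  refine ⟨fun x => prepend α (appendSeq (w x.1) x.2), fun x => ?_, fun x y hxy => ?_,
    fun x => ⟨_, rfl⟩⟩
  · refine ⟨(x.1, []), (α.1, α.2 ++ w x.1), ⟨x.2, ?_⟩, fun ψ => ?_⟩
    · simp [prepend, appendSeq_nil]
    · rw [prepend_append]
      simp [prepend, appendSeq_nil]
  · obtain ⟨h1, h2⟩ := appendSeq_inj (by simp [w]) (prepend_injective α hxy)
    exact Prod.ext (hw h1) h2

end CantorSp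

/-! ### Constructing elements of the Higman–Thompson group -/

namespace HigmanThompson

open Filter Topology CantorSp
open scoped commutatorElement

variable {n r : ℕ}

theorem ext {f g : HigmanThompson n r} (h : ∀ x, f.1 x = g.1 x) : f = g :=
  Subtype.ext (Homeomorph.ext h)

theorem mul_apply (f g : HigmanThompson n r) (x : CantorSp n r) : (f * g).1 x = f.1 (g.1 x) :=
  rfl

theorem inv_apply_self (f : HigmanThompson n r) (x : CantorSp n r) : f⁻¹.1 (f.1 x) = x :=
  f.1.symm_apply_apply x

theorem apply_inv_self (f : HigmanThompson n r) (x : CantorSp n r) : f.1 (f⁻¹.1 x) = x :=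
  f.1.apply_symm_apply x

theorem isLocallyPrefix (f : HigmanThompson n r) : IsLocallyPrefix f.1 := f.2

/-- A bijective local prefix replacement, as an element of the Higman–Thompson group. -/
def ofPerm (f : Equiv.Perm (CantorSp n r)) (hf : IsLocallyPrefix f) : HigmanThompson n r :=
  ⟨{ toEquiv := f
     continuous_toFun := hf.continuous
     continuous_invFun := hf.symm.continuous }, hf⟩

/-- The element that exchanges a clopen set with a disjoint copy of it: it acts as `e` on `A`, as
the inverse of `e` on the image of `A`, and trivially elsewhere. -/
theorem exists_swap {A : Set (CantorSp n r)} (hA : IsClopen A) {e : CantorSp n r → CantorSp n r}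
    (he : IsLocallyPrefix e) (hinj : Set.InjOn e A) (hdisj : ∀ x ∈ A, e x ∉ A) :
    ∃ h : HigmanThompson n r, (∀ x ∈ A, h.1 x = e x) ∧ ∀ x ∉ A, x ∉ e '' A → h.1 x = x := by
  classical
  let h : CantorSp n r → CantorSp n r := fun x =>
    if x ∈ A then e x else if hx : ∃ a ∈ A, e a = x then hx.choose else x
  have h1 : ∀ x ∈ A, h x = e x := fun x hx => if_pos hx
  have h2 : ∀ x ∈ A, h (e x) = x := by
    intro x hx
    have hex : ∃ a ∈ A, e a = e x := ⟨x, hx, rfl⟩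
    simp only [h, if_neg (hdisj x hx), dif_pos hex]
    exact hinj hex.choose_spec.1 hx hex.choose_spec.2
  have h3 : ∀ x ∉ A, x ∉ e '' A → h x = x := by
    intro x hx hx'
    have hex : ¬ ∃ a ∈ A, e a = x := hx'
    simp only [h, if_neg hx, dif_neg hex]
  have hinv : Function.Involutive h := by
    intro x
    by_cases hx : x ∈ A
    · rw [h1 x hx, h2 x hx]
    · by_cases hx' : x ∈ e '' A
      · obtain ⟨a, ha, rfl⟩ := hx'
        rw [h2 a ha, h1 a ha]
      · rw [h3 x hx hx', h3 x hx hx']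
  have hloc : IsLocallyPrefix h := by
    have hB : IsClosed (e '' A) := (hA.isClosed.isCompact.image he.continuous).isClosed
    intro x
    by_cases hx : x ∈ A
    · obtain ⟨k, ⟨β, hβ⟩, hk⟩ :=
        ((he.eventually x).and (eventually_cone_subset hA.isOpen hx)).exists
      exact ⟨_, β, mem_cone_initial x k, fun ψ => (h1 _ (hk ⟨ψ, rfl⟩)).trans (hβ ψ)⟩
    · by_cases hx' : x ∈ e '' A
      · obtain ⟨a, ha, rfl⟩ := hx'
        obtain ⟨k, ⟨β, hβ⟩, hk⟩ :=
          ((he.eventually a).and (eventually_cone_subset hA.isOpen ha)).exists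
        refine ⟨β, initial a k, hβ.apply_mem_cone (mem_cone_initial a k), fun ψ => ?_⟩
        rw [← hβ, h2 _ (hk ⟨ψ, rfl⟩)]
      · obtain ⟨k, hk⟩ := exists_cone_subset
          (hA.isClosed.isOpen_compl.inter hB.isOpen_compl) ⟨hx, hx'⟩
        exact ⟨_, _, mem_cone_initial x k,
          fun ψ => h3 _ (hk ⟨ψ, rfl⟩).1 (hk ⟨ψ, rfl⟩).2⟩
  exact ⟨ofPerm hinv.toPerm hloc, h1, h3⟩

/-- An injective local prefix replacement `ι` induces an endomorphism of the Higman–Thompson group: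
an element is transported to the range of `ι` and extended by the identity. -/
theorem exists_transport {ι : CantorSp n r → CantorSp n r} (hι : IsLocallyPrefix ι)
    (hinj : Function.Injective ι) :
    ∃ J : HigmanThompson n r →* HigmanThompson n r,
      (∀ f x, (J f).1 (ι x) = ι (f.1 x)) ∧ ∀ f, ∀ x ∉ Set.range ι, (J f).1 x = x := by
  let P (f : HigmanThompson n r) : Equiv.Perm (CantorSp n r) :=
    Equiv.Perm.viaEmbedding f.1.toEquiv ⟨ι, hinj⟩
  have h1 : ∀ f x, P f (ι x) = ι (f.1 x) := fun f x =>
    Equiv.Perm.viaEmbedding_apply f.1.toEquiv ⟨ι, hinj⟩ x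
  have h2 : ∀ f, ∀ x ∉ Set.range ι, P f x = x := fun f x hx =>
    Equiv.Perm.viaEmbedding_apply_of_notMem f.1.toEquiv ⟨ι, hinj⟩ x hx
  have hloc : ∀ f, IsLocallyPrefix (P f) := by
    intro f x
    by_cases hx : x ∈ Set.range ι
    · obtain ⟨y, rfl⟩ := hx
      obtain ⟨k, ⟨β, hβ⟩, γ, hγ⟩ :=
        ((hι.eventually y).and ((hι.comp (isLocallyPrefix f)).eventually y)).exists
      refine ⟨β, γ, hβ.apply_mem_cone (mem_cone_initial y k), fun ψ => ?_⟩
      rw [← hβ, h1]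
      exact hγ ψ
    · have hc : IsClosed (Set.range ι) := (isCompact_range hι.continuous).isClosed
      obtain ⟨k, hk⟩ := exists_cone_subset hc.isOpen_compl hx
      exact ⟨_, _, mem_cone_initial x k, fun ψ => h2 f _ (hk ⟨ψ, rfl⟩)⟩
  refine ⟨MonoidHom.mk' (fun f => ofPerm (P f) (hloc f)) fun f g => ext fun x => ?_, h1, h2⟩
  change P (f * g) x = P f (P g x)
  by_cases hx : x ∈ Set.range ι
  · obtain ⟨y, rfl⟩ := hx
    rw [h1, h1, h1]
    rfl
  · rw [h2 _ x hx, h2 _ x hx, h2 _ x hx]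

/-! ### Supports and moving clopen sets -/

/-- `f` is the identity outside `A`. -/
def SupportedIn (f : HigmanThompson n r) (A : Set (CantorSp n r)) : Prop :=
  ∀ x ∉ A, f.1 x = x

theorem SupportedIn.mono {f : HigmanThompson n r} {A B : Set (CantorSp n r)}
    (hf : SupportedIn f A) (h : A ⊆ B) : SupportedIn f B :=
  fun x hx => hf x fun hx' => hx (h hx')

theorem SupportedIn.mul {f g : HigmanThompson n r} {A : Set (CantorSp n r)}
    (hf : SupportedIn f A) (hg : SupportedIn g A) : SupportedIn (f * g) A := fun x hx => by
  rw [mul_apply, hg x hx, hf x hx]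

theorem SupportedIn.inv {f : HigmanThompson n r} {A : Set (CantorSp n r)}
    (hf : SupportedIn f A) : SupportedIn f⁻¹ A := fun x hx => by
  conv_lhs => rw [← hf x hx]
  exact inv_apply_self f x

theorem SupportedIn.apply_mem {f : HigmanThompson n r} {A : Set (CantorSp n r)}
    (hf : SupportedIn f A) {x : CantorSp n r} (hx : x ∈ A) : f.1 x ∈ A := by
  by_contra h
  exact h (by rwa [f.1.injective (hf _ h)])

theorem SupportedIn.conj {f : HigmanThompson n r} {A : Set (CantorSp n r)}
    (hf : SupportedIn f A) (h : HigmanThompson n r) : SupportedIn (h * f * h⁻¹) (h.1 '' A) := by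
  intro x hx
  rw [mul_apply, mul_apply, hf _ fun h' => hx ⟨_, h', apply_inv_self h x⟩, apply_inv_self]

theorem SupportedIn.commute {f g : HigmanThompson n r} {A B : Set (CantorSp n r)}
    (hf : SupportedIn f A) (hg : SupportedIn g B) (hAB : Disjoint A B) : Commute f g := by
  refine ext fun x => ?_
  rw [mul_apply, mul_apply]
  by_cases hA : x ∈ A
  · rw [hg x (hAB.notMem_of_mem_left hA), hg _ (hAB.notMem_of_mem_left (hf.apply_mem hA))]
  · rw [hf x hA]
    by_cases hB : x ∈ B
    · rw [hf _ (hAB.notMem_of_mem_right (hg.apply_mem hB))]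
    · rw [hg x hB, hf x hA]

theorem isClopen_image (f : HigmanThompson n r) {A : Set (CantorSp n r)} (hA : IsClopen A) :
    IsClopen (f.1 '' A) :=
  ⟨f.1.isClosedMap A hA.isClosed, f.1.isOpenMap A hA.isOpen⟩

theorem commutatorElement_mem (f g : HigmanThompson n r) :
    ⁅f, g⁆ ∈ commutator (HigmanThompson n r) :=
  Subgroup.commutator_mem_commutator (Subgroup.mem_top f) (Subgroup.mem_top g)

/-- Every clopen set can be exchanged with a subset of any disjoint cone. -/
theorem exists_move (hn : 2 ≤ n) {A : Set (CantorSp n r)} (hA : IsClopen A) {α : CPrefix n r}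
    (hd : Disjoint A (cone α)) :
    ∃ h : HigmanThompson n r, SupportedIn h (A ∪ cone α) ∧ ∀ x ∈ A, h.1 x ∈ cone α := by
  obtain ⟨e, he, hinj, heα⟩ := exists_embedding_into_cone hn α
  obtain ⟨h, h1, h2⟩ := exists_swap hA he hinj.injOn fun x _ => hd.notMem_of_mem_right (heα x)
  refine ⟨h, fun x hx => h2 x (fun h' => hx (Or.inl h')) ?_, fun x hx => ?_⟩
  · rintro ⟨a, -, rfl⟩
    exact hx (Or.inr (heα a))
  · rw [h1 x hx]
    exact heα x

/-- A nonempty open set contains a cone that avoids a given finite set. -/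
theorem exists_cone_avoiding (hn : 2 ≤ n) {U F : Set (CantorSp n r)} (hU : IsOpen U)
    (hne : U.Nonempty) (hF : F.Finite) :
    ∃ x k, cone (initial x k) ⊆ U ∧ Disjoint (cone (initial x k)) F := by
  obtain ⟨x, hxU, hxF⟩ := nonempty_diff_of_finite hn hU hne hF
  obtain ⟨k, hk⟩ := exists_cone_subset (hU.inter hF.isClosed.isOpen_compl) ⟨hxU, hxF⟩
  exact ⟨x, k, fun y hy => (hk hy).1, Set.disjoint_left.2 fun y hy => (hk hy).2⟩

/-- A nonempty open set contains a cone whose complement in it is nonempty. -/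
theorem exists_cone_ssubset (hn : 2 ≤ n) {U : Set (CantorSp n r)} (hU : IsOpen U)
    (hne : U.Nonempty) :
    ∃ x k, cone (initial x k) ⊆ U ∧ (U \ cone (initial x k)).Nonempty := by
  obtain ⟨z, hz⟩ := hne
  obtain ⟨x, k, h1, h2⟩ := exists_cone_avoiding hn hU ⟨z, hz⟩ (Set.finite_singleton z)
  exact ⟨x, k, h1, z, hz, Set.disjoint_singleton_right.1 h2⟩

theorem isOpen_diff_cone {U : Set (CantorSp n r)} (hU : IsOpen U) (x : CantorSp n r) (k : ℕ) :
    IsOpen (U \ cone (initial x k)) :=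
  hU.sdiff (isClopen_cone_initial x k).isClosed

/-- `exists_move` with the moving element in the commutator subgroup: an element moving `A` into
half of the cone is divided by a conjugate of itself that is supported in the other half. -/
theorem exists_move_mem_commutator (hn : 2 ≤ n) {A : Set (CantorSp n r)} (hA : IsClopen A)
    {x : CantorSp n r} {k : ℕ} (hd : Disjoint A (cone (initial x k))) :
    ∃ h ∈ commutator (HigmanThompson n r), ∀ y ∈ A, h.1 y ∈ cone (initial x k) := by
  obtain ⟨p, i, hp, hp'⟩ :=
    exists_cone_ssubset hn (isClopen_cone_initial x k).isOpen ⟨x, mem_cone_initial x k⟩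
  obtain ⟨q, j, hq, -⟩ :=
    exists_cone_ssubset hn (isOpen_diff_cone (isClopen_cone_initial x k).isOpen p i) hp'
  obtain ⟨h, hs, hA'⟩ := exists_move hn hA (hd.mono_right hp)
  have hdq : Disjoint (A ∪ cone (initial p i)) (cone (initial q j)) :=
    Set.disjoint_union_left.2 ⟨hd.mono_right fun y hy => (hq hy).1,
      Set.disjoint_right.2 fun y hy => (hq hy).2⟩
  obtain ⟨t, -, ht⟩ := exists_move hn (hA.union (isClopen_cone_initial p i)) hdq
  refine ⟨⁅h, t⁆, commutatorElement_mem h t, fun y hy => ?_⟩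
  have h1 : SupportedIn (t * h⁻¹ * t⁻¹) (cone (initial q j)) :=
    (hs.inv.conj t).mono (Set.image_subset_iff.2 ht)
  have h2 : ⁅h, t⁆ = h * (t * h⁻¹ * t⁻¹) := by
    rw [commutatorElement_def]
    group
  rw [h2, mul_apply, h1 y (hdq.notMem_of_mem_left (Or.inl hy))]
  exact hp (hA' y hy)

theorem exists_move_mem_commutator_of_ne_univ (hn : 2 ≤ n) {A : Set (CantorSp n r)}
    (hA : IsClopen A) (hne : A ≠ Set.univ) (x : CantorSp n r) (k : ℕ) :
    ∃ h ∈ commutator (HigmanThompson n r), ∀ y ∈ A, h.1 y ∈ cone (initial x k) := by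
  have hAc : (Aᶜ).Nonempty := Set.nonempty_compl.2 hne
  by_cases hU : (Aᶜ \ cone (initial x k)).Nonempty
  · -- The set `A` is first moved to a cone outside `A` and the target, and then to the target.
    obtain ⟨p, i, hp, -⟩ :=
      exists_cone_ssubset hn (isOpen_diff_cone hA.compl.isOpen x k) hU
    obtain ⟨h, hh, hA'⟩ := exists_move_mem_commutator hn hA (x := p) (k := i)
      (Set.disjoint_right.2 fun y hy => (hp hy).1)
    obtain ⟨t, ht, hp'⟩ := exists_move_mem_commutator hn (isClopen_cone_initial p i) (x := x)
      (k := k) (Set.disjoint_left.2 fun y hy => (hp hy).2)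
    exact ⟨t * h, mul_mem ht hh, fun y hy => hp' _ (hA' y hy)⟩
  · rw [Set.not_nonempty_iff_eq_empty, Set.sdiff_eq_empty] at hU
    obtain ⟨p, i, hp, -⟩ := exists_cone_ssubset hn hA.compl.isOpen hAc
    obtain ⟨h, hh, hA'⟩ := exists_move_mem_commutator hn hA (x := p) (k := i)
      (Set.disjoint_right.2 hp)
    exact ⟨h, hh, fun y hy => hU (hp (hA' y hy))⟩

/-! ### Simplicity of the commutator subgroup -/

theorem commute_mk_iff {G : Type*} [Group G] {M : Subgroup G} [M.Normal] {f g : G} :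
    Commute (QuotientGroup.mk' M f) (QuotientGroup.mk' M g) ↔ ⁅f, g⁆ ∈ M := by
  rw [← commutatorElement_eq_one_iff_commute, ← map_commutatorElement, QuotientGroup.mk'_apply,
    QuotientGroup.eq_one_iff]

theorem commutatorElement_mul_mul {G : Type*} [Group G] {f f' g g' : G} (h1 : Commute f g')
    (h2 : Commute f' g) (h3 : Commute f' g') : ⁅f * f', g * g'⁆ = ⁅f, g⁆ := by
  have h : f' * (g * g') = g * g' * f' := (h2.mul_right h3).eq
  have h' : g' * f⁻¹ = f⁻¹ * g' := h1.inv_left.eq.symm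
  calc ⁅f * f', g * g'⁆ = f * (f' * (g * g')) * f'⁻¹ * f⁻¹ * (g * g')⁻¹ := by
        rw [commutatorElement_def]; group
    _ = f * g * (g' * f⁻¹) * (g * g')⁻¹ := by rw [h]; group
    _ = ⁅f, g⁆ := by rw [h', commutatorElement_def]; group

/-- `M` contains the commutators of elements of the commutator subgroup that have a common proper
clopen support. -/
def ContainsLocalCommutators (M : Subgroup (HigmanThompson n r)) : Prop :=
  ∀ A : Set (CantorSp n r), IsClopen A → A ≠ Set.univ → ∀ a ∈ commutator (HigmanThompson n r),
    ∀ b ∈ commutator (HigmanThompson n r), SupportedIn a A → SupportedIn b A → ⁅a, b⁆ ∈ M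

variable {M : Subgroup (HigmanThompson n r)}

/-- Multiplying `f` and `g` by displaced copies of their inverses makes them elements of the
commutator subgroup without changing their commutator. -/
theorem ContainsLocalCommutators.commutatorElement_mem (hn : 2 ≤ n)
    (hM : ContainsLocalCommutators M) {A : Set (CantorSp n r)} (hA : IsClopen A)
    (hne : A ≠ Set.univ) {f g : HigmanThompson n r} (hf : SupportedIn f A)
    (hg : SupportedIn g A) : ⁅f, g⁆ ∈ M := by
  obtain ⟨p, i, hp, hp'⟩ :=
    exists_cone_ssubset hn hA.compl.isOpen (Set.nonempty_compl.2 hne)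
  obtain ⟨q, j, hq, z, hz, hzq⟩ :=
    exists_cone_ssubset hn (isOpen_diff_cone hA.compl.isOpen p i) hp'
  have hAp : Disjoint A (cone (initial p i)) := Set.disjoint_right.2 hp
  have hAq : Disjoint A (cone (initial q j)) := Set.disjoint_right.2 fun y hy => (hq hy).1
  have hpq : Disjoint (cone (initial p i)) (cone (initial q j)) :=
    Set.disjoint_right.2 fun y hy => (hq hy).2
  obtain ⟨s, -, hs⟩ := exists_move hn hA hAp
  obtain ⟨t, -, ht⟩ := exists_move hn hA hAq
  have hf' : SupportedIn (s * f⁻¹ * s⁻¹) (cone (initial p i)) :=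
    (hf.inv.conj s).mono (Set.image_subset_iff.2 hs)
  have hg' : SupportedIn (t * g⁻¹ * t⁻¹) (cone (initial q j)) :=
    (hg.inv.conj t).mono (Set.image_subset_iff.2 ht)
  have h := hM (A ∪ (cone (initial p i) ∪ cone (initial q j)))
    (hA.union ((isClopen_cone_initial p i).union (isClopen_cone_initial q j)))
    (Set.ne_univ_iff_exists_notMem _ |>.2 ⟨z, by
      rintro (h | h | h)
      exacts [hz.1 h, hz.2 h, hzq h]⟩)
    (f * (s * f⁻¹ * s⁻¹)) (by
      convert HigmanThompson.commutatorElement_mem f s using 1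
      rw [commutatorElement_def]; group)
    (g * (t * g⁻¹ * t⁻¹)) (by
      convert HigmanThompson.commutatorElement_mem g t using 1
      rw [commutatorElement_def]; group)
    ((hf.mono Set.subset_union_left).mul
      (hf'.mono fun y hy => Or.inr (Or.inl hy)))
    ((hg.mono Set.subset_union_left).mul
      (hg'.mono fun y hy => Or.inr (Or.inr hy)))
  rwa [commutatorElement_mul_mul (hf.commute hg' hAq)
    (hg.commute hf' hAp).symm (hf'.commute hg' hpq)] at h

/-- Modulo `M`, the support of an element can be pushed into a disjoint cone. -/
theorem ContainsLocalCommutators.exists_mk_eq (hn : 2 ≤ n) [M.Normal]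
    (hM : ContainsLocalCommutators M) {A : Set (CantorSp n r)} (hA : IsClopen A)
    {x : CantorSp n r} {k : ℕ} (hd : Disjoint A (cone (initial x k)))
    (hne : A ∪ cone (initial x k) ≠ Set.univ) {f : HigmanThompson n r} (hf : SupportedIn f A) :
    ∃ f', SupportedIn f' (cone (initial x k)) ∧
      QuotientGroup.mk' M f = QuotientGroup.mk' M f' := by
  obtain ⟨h, hs, hx⟩ := exists_move hn hA hd
  refine ⟨h * f * h⁻¹, (hf.conj h).mono (Set.image_subset_iff.2 hx), ?_⟩
  have := commute_mk_iff.2 (hM.commutatorElement_mem hn (hA.union (isClopen_cone_initial x k)) hne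
    hs (hf.mono Set.subset_union_left))
  rw [map_mul, map_mul, this.eq, map_inv, mul_inv_cancel_right]

theorem ContainsLocalCommutators.commute_mk (hn : 2 ≤ n) [M.Normal]
    (hM : ContainsLocalCommutators M) {A B : Set (CantorSp n r)} (hA : IsClopen A)
    (hB : IsClopen B) (hA' : A ≠ Set.univ) (hB' : B ≠ Set.univ) {f g : HigmanThompson n r}
    (hf : SupportedIn f A) (hg : SupportedIn g B) :
    Commute (QuotientGroup.mk' M f) (QuotientGroup.mk' M g) := by
  -- Both supports are pushed into cones whose union omits the point `a`.
  obtain ⟨a, ha⟩ := Set.nonempty_compl.2 hA'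
  obtain ⟨b, hb⟩ := Set.nonempty_compl.2 hB'
  obtain ⟨p, i, hp, hpF⟩ := exists_cone_avoiding hn hA.compl.isOpen ⟨a, ha⟩ (Set.finite_singleton a)
  obtain ⟨q, j, hq, hqF⟩ := exists_cone_avoiding hn hB.compl.isOpen ⟨b, hb⟩
    (Set.toFinite {a, b})
  have hap : a ∉ cone (initial p i) := Set.disjoint_right.1 hpF rfl
  have haq : a ∉ cone (initial q j) := Set.disjoint_right.1 hqF (Or.inl rfl)
  have hbq : b ∉ cone (initial q j) := Set.disjoint_right.1 hqF (Or.inr rfl)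
  obtain ⟨f', hf', hff'⟩ := hM.exists_mk_eq hn hA (Set.disjoint_right.2 hp)
    (Set.ne_univ_iff_exists_notMem _ |>.2 ⟨a, fun h => h.elim ha hap⟩) hf
  obtain ⟨g', hg', hgg'⟩ := hM.exists_mk_eq hn hB (Set.disjoint_right.2 hq)
    (Set.ne_univ_iff_exists_notMem _ |>.2 ⟨b, fun h => h.elim hb hbq⟩) hg
  rw [hff', hgg', commute_mk_iff]
  exact hM.commutatorElement_mem hn ((isClopen_cone_initial p i).union (isClopen_cone_initial q j))
    (Set.ne_univ_iff_exists_notMem _ |>.2 ⟨a, fun h => h.elim hap haq⟩)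
    (hf'.mono Set.subset_union_left) (hg'.mono Set.subset_union_right)

/-- A nontrivial element displaces a cone from itself, and the two cones can be chosen to avoid a
given point. -/
theorem exists_displaced_cone (hn : 2 ≤ n) {f : HigmanThompson n r} (hf : f ≠ 1) :
    ∃ x k, (∀ y ∈ cone (initial x k), f.1 y ∉ cone (initial x k)) ∧
      ∃ z, z ∉ cone (initial x k) ∧ z ∉ f.1 '' cone (initial x k) := by
  obtain ⟨x, hx⟩ : ∃ x, f.1 x ≠ x := by
    by_contra! h
    exact hf (ext h)
  obtain ⟨z, -, hz⟩ := nonempty_diff_of_finite hn isOpen_univ ⟨x, trivial⟩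
    (Set.toFinite {x, f.1 x})
  rw [Set.mem_insert_iff, Set.mem_singleton_iff, not_or] at hz
  obtain ⟨U, W, hU, hW, hxU, hxW, hUW⟩ := t2_separation hx
  have h1 : IsOpen (W ∩ f.1 ⁻¹' U ∩ ({z}ᶜ ∩ f.1 ⁻¹' {z}ᶜ)) :=
    (hW.inter (hU.preimage f.1.continuous)).inter
      (isOpen_compl_singleton.inter (isOpen_compl_singleton.preimage f.1.continuous))
  obtain ⟨k, hk⟩ := exists_cone_subset h1 (x := x)
    ⟨⟨hxW, hxU⟩, fun h => hz.1 h.symm, fun h => hz.2 h.symm⟩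
  refine ⟨x, k, fun y hy hy' => ?_, z, fun h => (hk h).2.1 rfl, ?_⟩
  · exact hUW.notMem_of_mem_left (hk hy).1.2 (hk hy').1.1
  · rintro ⟨y, hy, rfl⟩
    exact (hk hy).2.2 rfl

/-- Every element is a product of two elements with proper clopen supports: the first agrees with
`f` on a small cone, and the second is trivial there. -/
theorem exists_eq_mul_supportedIn (hn : 2 ≤ n) (hr : 1 ≤ r) (f : HigmanThompson n r) :
    ∃ (A B : Set (CantorSp n r)) (a b : HigmanThompson n r), IsClopen A ∧ IsClopen B ∧
      A ≠ Set.univ ∧ B ≠ Set.univ ∧ SupportedIn a A ∧ SupportedIn b B ∧ f = a * b := by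
  by_cases hf : f = 1
  · have := nonempty_of_pos hn hr
    exact ⟨∅, ∅, 1, 1, isClopen_empty, isClopen_empty, Set.empty_ne_univ, Set.empty_ne_univ,
      fun _ _ => rfl, fun _ _ => rfl, by rw [hf, one_mul]⟩
  · obtain ⟨x, k, hd, z, hz, hz'⟩ := exists_displaced_cone hn hf
    have hC := isClopen_cone_initial x k
    obtain ⟨h, h1, h2⟩ := exists_swap hC (isLocallyPrefix f) f.1.injective.injOn hd
    refine ⟨cone (initial x k) ∪ f.1 '' cone (initial x k), (cone (initial x k))ᶜ, h, h⁻¹ * f,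
      hC.union (isClopen_image f hC), hC.compl, ?_, ?_, ?_, ?_, by group⟩
    · exact Set.ne_univ_iff_exists_notMem _ |>.2 ⟨z, fun h => h.elim hz hz'⟩
    · exact Set.ne_univ_iff_exists_notMem _ |>.2 ⟨x, fun h => h (mem_cone_initial x k)⟩
    · exact fun y hy => h2 y (fun h => hy (Or.inl h)) fun h => hy (Or.inr h)
    · intro y hy
      rw [Set.notMem_compl_iff] at hy
      rw [mul_apply, ← h1 y hy, inv_apply_self]

theorem ContainsLocalCommutators.commutator_le (hn : 2 ≤ n) (hr : 1 ≤ r) [M.Normal]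
    (hM : ContainsLocalCommutators M) : commutator (HigmanThompson n r) ≤ M := by
  rw [commutator_def, Subgroup.commutator_le]
  intro f _ g _
  obtain ⟨A, B, a, b, hA, hB, hA', hB', ha, hb, rfl⟩ := exists_eq_mul_supportedIn hn hr f
  obtain ⟨C, D, c, d, hC, hD, hC', hD', hc, hd, rfl⟩ := exists_eq_mul_supportedIn hn hr g
  rw [← commute_mk_iff, map_mul, map_mul]
  exact ((hM.commute_mk hn hA hC hA' hC' ha hc).mul_right
    (hM.commute_mk hn hA hD hA' hD' ha hd)).mul_left
    ((hM.commute_mk hn hB hC hB' hC' hb hc).mul_right (hM.commute_mk hn hB hD hB' hD' hb hd))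

/-- A nontrivial subgroup of the commutator subgroup that is normalized by it is everything. The
double commutator `⁅⁅g, a⁆, b⁆` of elements `a`, `b` supported in a cone displaced by `g` equals
`⁅a⁻¹, b⁆`, and every proper clopen set can be moved into that cone. -/
theorem commutator_le_of_normalized (hn : 2 ≤ n) (hr : 1 ≤ r) {N : Subgroup (HigmanThompson n r)}
    (hN : ∀ g ∈ N, ∀ h ∈ commutator (HigmanThompson n r), h * g * h⁻¹ ∈ N)
    (hne : ∃ g ∈ N, g ≠ 1) : commutator (HigmanThompson n r) ≤ N := by
  obtain ⟨g, hgN, hg⟩ := hne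
  obtain ⟨x, k, hd, -⟩ := exists_displaced_cone hn hg
  have hN' : ∀ g ∈ N, ∀ h ∈ commutator (HigmanThompson n r), ⁅g, h⁆ ∈ N := by
    intro g hg h hh
    have := mul_mem hg (hN g⁻¹ (inv_mem hg) h hh)
    convert this using 1
    rw [commutatorElement_def]; group
  have hcone : ∀ a ∈ commutator (HigmanThompson n r), ∀ b ∈ commutator (HigmanThompson n r),
      SupportedIn a (cone (initial x k)) → SupportedIn b (cone (initial x k)) → ⁅a, b⁆ ∈ N := by
    intro a ha b hb has hbs
    have hdisj : Disjoint (g.1 '' cone (initial x k)) (cone (initial x k)) := by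
      rw [Set.disjoint_left]
      rintro _ ⟨y, hy, rfl⟩
      exact hd y hy
    have hc : SupportedIn (g * a⁻¹ * g⁻¹) (g.1 '' cone (initial x k)) := has.inv.conj g
    have h1 : ⁅g, a⁻¹⁆ = a * (g * a⁻¹ * g⁻¹) := by
      rw [(has.commute hc hdisj.symm).eq, commutatorElement_def]; group
    have h2 := hN' _ (hN' g hgN a⁻¹ (inv_mem ha)) b hb
    rwa [h1, ← mul_one b, commutatorElement_mul_mul
      (Commute.one_right _) (hc.commute hbs hdisj) (Commute.one_right _)] at h2
  have hlocal : ContainsLocalCommutators N := by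
    intro A hA hA' a ha b hb has hbs
    obtain ⟨h, hh, hAx⟩ := exists_move_mem_commutator_of_ne_univ hn hA hA' x k
    have h1 := hcone _ (Subgroup.Normal.conj_mem inferInstance a ha h) _
      (Subgroup.Normal.conj_mem inferInstance b hb h)
      ((has.conj h).mono (Set.image_subset_iff.2 hAx))
      ((hbs.conj h).mono (Set.image_subset_iff.2 hAx))
    rw [← conjugate_commutatorElement] at h1
    convert hN _ h1 h⁻¹ (inv_mem hh) using 1
    group
  -- `N` need not be normal in the whole group, so its normal core is used.
  have hcore : ContainsLocalCommutators N.normalCore := by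
    intro A hA hA' a ha b hb has hbs c
    rw [conjugate_commutatorElement]
    refine hlocal (c.1 '' A) (isClopen_image c hA) ?_ _
      (Subgroup.Normal.conj_mem inferInstance a ha c) _
      (Subgroup.Normal.conj_mem inferInstance b hb c) (has.conj c) (hbs.conj c)
    rw [Ne, ← Set.image_univ_of_surjective c.1.surjective, c.1.injective.image_injective.eq_iff]
    exact hA'
  exact (hcore.commutator_le hn hr).trans N.normalCore_le

/-! ### Stabilizers of finite sets -/

variable {S : Set (CantorSp n r)}

theorem fixNear_le_fix (S : Set (CantorSp n r)) : FixNear S ≤ Fix S := by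
  rintro f ⟨U, -, hSU, hf⟩ x hx
  exact hf x (hSU hx)

/-- Degrees of germs add up, so a commutator of elements fixing a point has degree zero there. -/
theorem commutator_fix_le_fixNear (S : Set (CantorSp n r)) : ⁅Fix S, Fix S⁆ ≤ FixNear S := by
  rw [Subgroup.commutator_le]
  intro f hf g hg
  -- The degree of the commutator at `s` is `d + (e + (-d + -e)) = 0`.
  have key : ∀ s ∈ S, ∃ k, ∀ y ∈ cone (initial s k), (⁅f, g⁆ : HigmanThompson n r).1 y = y := by
    intro s hs
    obtain ⟨d, hd⟩ := isLocallyPrefix_iff.1 (isLocallyPrefix f) s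
    obtain ⟨e, he⟩ := isLocallyPrefix_iff.1 (isLocallyPrefix g) s
    have hf' : f⁻¹.1 s = s := (Fix S).inv_mem hf s hs
    have hg' : g⁻¹.1 s = s := (Fix S).inv_mem hg s hs
    have hd' : HasDegreeAt f⁻¹.1 s (-d) := by
      have := HasDegreeAt.symm (f := f.1.toEquiv) hd
      rwa [show f.1.toEquiv s = s from hf s hs] at this
    have he' : HasDegreeAt g⁻¹.1 s (-e) := by
      have := HasDegreeAt.symm (f := g.1.toEquiv) he
      rwa [show g.1.toEquiv s = s from hg s hs] at this
    rw [← hg'] at hd'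
    have h1 := hd'.comp he'
    have h2 : (f⁻¹.1 ∘ g⁻¹.1) s = s := by rw [Function.comp_apply, hg', hf']
    rw [← h2] at he
    have h3 := he.comp h1
    have h4 : (g.1 ∘ f⁻¹.1 ∘ g⁻¹.1) s = s := by rw [Function.comp_apply, h2, hg s hs]
    rw [← h4] at hd
    have h5 := hd.comp h3
    rw [show d + (e + (-d + -e)) = 0 by ring] at h5
    exact h5.eqOn_of_fixed (by rw [Function.comp_apply, h4, hf s hs])
  choose! k hk using key
  refine ⟨⋃ s ∈ S, cone (initial s (k s)),
    isOpen_biUnion fun s _ => (isClopen_cone_initial s (k s)).isOpen,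
    fun s hs => Set.mem_biUnion hs (mem_cone_initial s (k s)), fun x hx => ?_⟩
  obtain ⟨s, hs, hx⟩ := Set.mem_iUnion₂.1 hx
  exact hk s hs x hx

/-- Any two elements that are trivial near `S` are fixed by an endomorphism of the whole group whose
values are all trivial near `S`. The endomorphism is the transport along
a map that is the identity away from `S` and squeezes a neighborhood of `S` into a cone avoiding
`S`. -/
theorem exists_endomorphism_into_fixNear (hn : 2 ≤ n) (hS : S.Finite) {f g : HigmanThompson n r}
    (hf : f ∈ FixNear S) (hg : g ∈ FixNear S) :
    ∃ J : HigmanThompson n r →* HigmanThompson n r,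
      (∀ h, J h ∈ FixNear S) ∧ J f = f ∧ J g = g := by
  classical
  obtain ⟨U, hU, hSU, hfU⟩ := hf
  obtain ⟨W, hW, hSW, hgW⟩ := hg
  rcases S.eq_empty_or_nonempty with rfl | ⟨s₀, hs₀⟩
  · exact ⟨MonoidHom.id _, fun h => ⟨∅, isOpen_empty, subset_rfl, fun x hx => hx.elim⟩, rfl, rfl⟩
  have hcone : ∀ s ∈ S, ∃ k, cone (initial s k) ⊆ U ∩ W := fun s hs =>
    exists_cone_subset (hU.inter hW) ⟨hSU hs, hSW hs⟩
  choose! k hk using hcone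
  set B : Set (CantorSp n r) := ⋃ s ∈ S, cone (initial s (k s)) with hB
  have hBc : IsClopen B := hS.isClopen_biUnion fun s _ => isClopen_cone_initial s (k s)
  have hSB : S ⊆ B := fun s hs => Set.mem_biUnion hs (mem_cone_initial s (k s))
  have hBU : B ⊆ U ∩ W := Set.iUnion₂_subset hk
  obtain ⟨p, i, hp, hpS⟩ := exists_cone_avoiding hn hBc.isOpen ⟨s₀, hSB hs₀⟩ hS
  obtain ⟨e, he, hinj, hep⟩ := exists_embedding_into_cone hn (initial p i)
  -- The cone at `p` lies in `B`, so `ι` stays injective, and it avoids `S`, so the range of `ι`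
  -- misses a neighborhood of `S`.
  let ι : CantorSp n r → CantorSp n r := fun x => if x ∈ B then e x else x
  have hι1 : ∀ x ∈ B, ι x = e x := fun x hx => if_pos hx
  have hι2 : ∀ x ∉ B, ι x = x := fun x hx => if_neg hx
  have hι : IsLocallyPrefix ι := by
    refine isLocallyPrefix_of_local fun x => ?_
    by_cases hx : x ∈ B
    · exact ⟨B, e, hBc.isOpen, hx, he, hι1⟩
    · exact ⟨Bᶜ, id, hBc.compl.isOpen, hx, isLocallyPrefix_id, hι2⟩
  have hιB : ∀ x ∈ B, ι x ∈ cone (initial p i) := fun x hx => by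
    rw [hι1 x hx]
    exact hep x
  have hιinj : Function.Injective ι := by
    intro x y hxy
    by_cases hx : x ∈ B <;> by_cases hy : y ∈ B
    · rw [hι1 x hx, hι1 y hy] at hxy
      exact hinj hxy
    · exact (hy (by rw [← hι2 y hy, ← hxy]; exact hp (hιB x hx))).elim
    · exact (hx (by rw [← hι2 x hx, hxy]; exact hp (hιB y hy))).elim
    · rwa [hι2 x hx, hι2 y hy] at hxy
  obtain ⟨J, hJ1, hJ2⟩ := exists_transport hι hιinj
  have hfix : ∀ h : HigmanThompson n r, (∀ x ∈ B, h.1 x = x) → J h = h := by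
    intro h hh
    have hs : SupportedIn h Bᶜ := fun x hx => hh x (Set.notMem_compl_iff.1 hx)
    refine ext fun x => ?_
    by_cases hx : x ∈ B
    · by_cases hx' : x ∈ Set.range ι
      · obtain ⟨y, rfl⟩ := hx'
        have hy : y ∈ B := by
          by_contra hy
          exact hy (by rwa [hι2 y hy] at hx)
        rw [hJ1, hh y hy, hh _ hx]
      · rw [hJ2 h x hx', hh x hx]
    · conv_lhs => rw [← hι2 x hx, hJ1, hι2 _ (hs.apply_mem hx)]
  refine ⟨J, fun h => ⟨B ∩ (cone (initial p i))ᶜ,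
    hBc.isOpen.inter (isClopen_cone_initial p i).compl.isOpen,
    fun s hs => ⟨hSB hs, Set.disjoint_right.1 hpS hs⟩, ?_⟩,
    hfix f fun x hx => hfU x (hBU hx).1, hfix g fun x hx => hgW x (hBU hx).2⟩
  rintro x ⟨hxB, hxp⟩
  refine hJ2 h x ?_
  rintro ⟨y, rfl⟩
  by_cases hy : y ∈ B
  · exact hxp (hιB y hy)
  · exact hy (by rwa [hι2 y hy] at hxB)

theorem apply_mem_commutator {G H : Type*} [Group G] [Group H] (J : G →* H) {f : G}
    {K : Subgroup H} (hJ : ∀ h, J h ∈ K) (hf : f ∈ commutator G) : J f ∈ ⁅K, K⁆ := by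
  have h := Subgroup.mem_map_of_mem J hf
  rw [commutator_def, Subgroup.map_commutator] at h
  have hle : (⊤ : Subgroup G).map J ≤ K := by
    rintro _ ⟨x, -, rfl⟩
    exact hJ x
  exact Subgroup.commutator_mono hle hle h

theorem commutator_fix_eq (hn : 2 ≤ n) (hS : S.Finite) :
    ⁅Fix S, Fix S⁆ = FixNear S ⊓ commutator (HigmanThompson n r) := by
  refine le_antisymm (le_inf (commutator_fix_le_fixNear S)
    (Subgroup.commutator_mono le_top le_top)) ?_
  rintro f ⟨hf, hf'⟩
  obtain ⟨J, hJ, hJf, -⟩ := exists_endomorphism_into_fixNear hn hS hf hf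
  rw [← hJf]
  exact Subgroup.commutator_mono (fixNear_le_fix S) (fixNear_le_fix S)
    (apply_mem_commutator J hJ hf')

/-- Two elements moving one cone into two different disjoint cones do not commute. -/
theorem exists_commutatorElement_ne_one (hn : 2 ≤ n) (hr : 1 ≤ r) (hS : S.Finite) :
    ∃ f ∈ FixNear S, ∃ g ∈ FixNear S, ⁅f, g⁆ ≠ 1 := by
  have := nonempty_of_pos hn hr
  obtain ⟨x, i, hx, hx'⟩ := exists_cone_ssubset hn hS.isClosed.isOpen_compl
    (Set.compl_eq_univ_sdiff S ▸ nonempty_diff_of_finite hn isOpen_univ Set.univ_nonempty hS)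
  have hU := isOpen_diff_cone hS.isClosed.isOpen_compl x i
  obtain ⟨y, j, hy, hy'⟩ := exists_cone_ssubset hn hU hx'
  obtain ⟨z, k, hz, -⟩ := exists_cone_ssubset hn (isOpen_diff_cone hU y j) hy'
  have hxy : Disjoint (cone (initial x i)) (cone (initial y j)) :=
    Set.disjoint_right.2 fun w hw => (hy hw).2
  have hxz : Disjoint (cone (initial x i)) (cone (initial z k)) :=
    Set.disjoint_right.2 fun w hw => (hz hw).1.2
  have hyz : Disjoint (cone (initial y j)) (cone (initial z k)) :=
    Set.disjoint_right.2 fun w hw => (hz hw).2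
  obtain ⟨f, hf, hfx⟩ := exists_move hn (isClopen_cone_initial x i) hxy
  obtain ⟨g, hg, hgx⟩ := exists_move hn (isClopen_cone_initial x i) hxz
  have hfix : ∀ (h : HigmanThompson n r) (A : Set (CantorSp n r)), IsClopen A → A ⊆ Sᶜ →
      SupportedIn h A → h ∈ FixNear S := fun h A hA hAS hh =>
    ⟨Aᶜ, hA.compl.isOpen, Set.subset_compl_comm.1 hAS, hh⟩
  refine ⟨f, hfix f _ ((isClopen_cone_initial x i).union (isClopen_cone_initial y j))
    (Set.union_subset hx fun w hw => (hy hw).1) hf,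
    g, hfix g _ ((isClopen_cone_initial x i).union (isClopen_cone_initial z k))
    (Set.union_subset hx fun w hw => (hz hw).1.1) hg, fun h => ?_⟩
  have hc := commutatorElement_eq_one_iff_mul_comm.1 h
  have hx0 := mem_cone_initial x i
  have h1 : (f * g).1 x = (g * f).1 x := by rw [hc]
  rw [mul_apply, mul_apply,
    hf _ fun h => h.elim (hxz.notMem_of_mem_right (hgx x hx0))
      (hyz.notMem_of_mem_right (hgx x hx0)),
    hg _ fun h => h.elim (hxy.notMem_of_mem_right (hfx x hx0))
      (hyz.notMem_of_mem_left (hfx x hx0))] at h1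
  exact hyz.notMem_of_mem_right (hgx x hx0) (h1 ▸ hfx x hx0)

/-- Given a normal subgroup with a nontrivial element `g`, and any `f`, there is an endomorphism `J`
of the whole group that fixes both and maps its commutator subgroup into this group. Pulling the
normal subgroup back along `J` reduces the claim to `commutator_le_of_normalized`. -/
theorem isSimpleGroup_commutator_fix (hn : 2 ≤ n) (hr : 1 ≤ r) (hS : S.Finite) :
    IsSimpleGroup ↥⁅Fix S, Fix S⁆ := by
  have hD := commutator_fix_eq hn hS
  have hnt : Nontrivial ↥⁅Fix S, Fix S⁆ := by
    obtain ⟨f, hf, g, hg, hne⟩ := exists_commutatorElement_ne_one hn hr hS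
    rw [Subgroup.nontrivial_iff_exists_ne_one]
    exact ⟨⁅f, g⁆, Subgroup.commutator_mem_commutator (fixNear_le_fix S hf) (fixNear_le_fix S hg),
      hne⟩
  refine { exists_pair_ne := hnt.exists_pair_ne, eq_bot_or_eq_top_of_normal := fun N hN => ?_ }
  rw [or_iff_not_imp_left]
  intro hbot
  obtain ⟨g, hgN, hg⟩ := N.nontrivial_iff_exists_ne_one.1 (N.nontrivial_iff_ne_bot.2 hbot)
  rw [eq_top_iff]
  rintro f -
  have hf' := hD.le f.2
  have hg' := hD.le g.2
  obtain ⟨J, hJ, hJf, hJg⟩ := exists_endomorphism_into_fixNear hn hS hf'.1 hg'.1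
  have hJD : ∀ h ∈ commutator (HigmanThompson n r), J h ∈ ⁅Fix S, Fix S⁆ := fun h hh =>
    Subgroup.commutator_mono (fixNear_le_fix S) (fixNear_le_fix S) (apply_mem_commutator J hJ hh)
  have key : commutator (HigmanThompson n r) ≤
      (N.map (Subgroup.subtype _)).comap J := by
    refine commutator_le_of_normalized hn hr ?_ ⟨g.1, ⟨g, hgN, hJg.symm⟩, ?_⟩
    · rintro a ⟨b, hb, hab⟩ h hh
      refine ⟨_, hN.conj_mem b hb ⟨J h, hJD h hh⟩, ?_⟩
      rw [map_mul, map_mul, map_inv, hab, map_mul, map_mul, map_inv, Subgroup.subtype_apply]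
    · exact fun h => hg (Subtype.ext h)
  obtain ⟨b, hb, hbf⟩ := key hf'.2
  rw [hJf] at hbf
  rwa [← Subtype.ext hbf]

end HigmanThompson

theorem mainTheorem3 (n r : ℕ) (hn : 2 ≤ n) (hr : 1 ≤ r)
    (S : Set (CantorSp n r)) (hS : S.Finite) (hrat : ∀ s ∈ S, CantorSp.IsRational s) :
    ⁅HigmanThompson.Fix S, HigmanThompson.Fix S⁆ =
        HigmanThompson.FixNear S ⊓ commutator (HigmanThompson n r) ∧
      IsSimpleGroup ↥⁅HigmanThompson.Fix S, HigmanThompson.Fix S⁆ :=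
  ⟨HigmanThompson.commutator_fix_eq hn hS,
    HigmanThompson.isSimpleGroup_commutator_fix hn hr hS⟩
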